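/- Let $H$ be a real separable infinite-dimensional Hilbert space with its Borel $\sigma$-algebra. For a Borel probability measure $\nu$ on $H$ let $\phi_\nu(w)=\int_H e^{\mathrm i\langle w,z\rangle}\,\nu(\mathrm dz)$, and let $\mathcal V$ be the set of Borel probability measures on $H$ that are symmetric ($\nu(A)=\nu(-A)$ for all Borel $A$, so that $\phi_\nu$ is real-valued) and have full support. For a Borel probability measure $F$ on $H^2$, with $(X,Y)\sim F$, $\phi_{X,Y}(w_1,w_2)=\mathbb E\,e^{\mathrm i\langle X,w_1\rangle+\mathrm i\langle Y,w_2\rangle}$, $\phi_X(w)=\mathbb E\,e^{\mathrm i\langle X,w\rangle}$ and $\phi_Y(w)=\mathbb E\,e^{\mathrm i\langle Y,w\rangle}$, let $$\mathrm{dCov}^2_\nu(F)=\int_{H^2}|\phi_{X,Y}(w_1,w_2)-\phi_X(w_1)\phi_Y(w_2)|^2\,\nu(\mathrm dw_1)\,\nu(\mathrm dw_2),\qquad \mathcal F_\nu(\rho)=\{F:\mathrm{dCov}^2_\nu(F)\ge\rho\}.$$ Let $(X_1,Y_1),\dots,(X_n,Y_n)$ be i.i.d. with law $F$ and, independently of them,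 let $\Pi_1,\dots,\Pi_B$ be i.i.d. uniform random permutations of $\{1,\dots,n\}$; $\mathbb P_F$ denotes the joint probability. Let $\widehat{\mathrm{dCov}}{}^2_\nu=\int_{H^2}|\hat\phi_{X,Y}(w_1,w_2)-\hat\phi_X(w_1)\hat\phi_Y(w_2)|^2\,\nu(\mathrm dw_1)\,\nu(\mathrm dw_2)$, where $\hat\phi_{X,Y}(w_1,w_2)=\frac1n\sum_j e^{\mathrm i\langle X_j,w_1\rangle+\mathrm i\langle Y_j,w_2\rangle}$, $\hat\phi_X(w)=\frac1n\sum_je^{\mathrm i\langle X_j,w\rangle}$ and $\hat\phi_Y(w)=\frac1n\sum_je^{\mathrm i\langle Y_j,w\rangle}$. For a permutation $\Pi$ let $$\widehat{\mathrm{dCov}}{}^2_\nu(\Pi)=\frac1{n^2}\sum_{k,\ell=1}^n\hat V^{X}_{k,\ell}\hat V^{Y}_{\Pi(k),\Pi(\ell)},$$ where $$\hat V^X_{k,\ell}=\phi_\nu(X_k-X_\ell)-\frac1n\sum_i\phi_\nu(X_i-X_\ell)-\frac1n\sum_j\phi_\nu(X_k-X_j)+\frac1{n^2}\sum_{i,j}\phi_\nu(X_i-X_j)$$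 and $\hat V^Y$ is defined in the same way from $Y_1,\dots,Y_n$. The permutation independence test is $$\hat\psi_{\nu,n}(\alpha)=\mathbf 1\Big\{\frac1B\sum_{b=1}^B\mathbf 1\big\{\widehat{\mathrm{dCov}}{}^2_\nu>\widehat{\mathrm{dCov}}{}^2_\nu(\Pi_b)\big\}>1-\alpha\Big\},$$ where $1$ means rejection of independence, and its uniform separation rate is $$\rho\{\hat\psi_{\nu,n}(\alpha),\beta\}=\inf\Big\{\rho>0:\ \sup_{\nu\in\mathcal V}\ \sup_{F\in\mathcal F_\nu(\rho)}\mathbb P_F\{\hat\psi_{\nu,n}(\alpha)=0\}\le\beta\Big\}.$$ **Theorem.** There is an absolute constant $c>0$ such that for all such $H$, all $\alpha,\beta>0$ with $\alpha+\beta<1$ and $\beta<1/e$, all integers $n\ge4$ and all positive integers $B\ge2\alpha^{-2}\log(6/\beta)$, $$\rho\{\hat\psi_{\nu,n}(\alpha),\beta\}\le c\,n^{-1/2}\{\log(\alpha^{-1})+\log(\beta^{-1})\}.$$ -/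

import Mathlib

open MeasureTheory
open scoped ENNReal RealInnerProductSpace

noncomputable section

namespace DistCov

variable {H : Type*} [NormedAddCommGroup H] [InnerProductSpace ℝ H] [MeasurableSpace H]

/-- The set of reference probability measures on `H`: symmetric, with full support. -/
def referenceMeasures (H : Type*) [NormedAddCommGroup H] [MeasurableSpace H] :
    Set (ProbabilityMeasure H) :=
  {ν | (∀ A : Set H, MeasurableSet A →
          (ν : Measure H) A = (ν : Measure H) ((fun w => -w) ⁻¹' A)) ∧
        (ν : Measure H).support = Set.univ}

/-- The joint characteristic functional `E exp(i⟪X, w₁⟫ + i⟪Y, w₂⟫)` of `(X, Y) ∼ F`. -/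
def jointCharFun (F : Measure (H × H)) (w₁ w₂ : H) : ℂ :=
  ∫ z : H × H, Complex.exp (Complex.I * (⟪z.1, w₁⟫ : ℝ) + Complex.I * (⟪z.2, w₂⟫ : ℝ)) ∂F

/-- The squared distance covariance of `(X, Y) ∼ F` with respect to `ν`. -/
def dCovSq (ν : ProbabilityMeasure H) (F : ProbabilityMeasure (H × H)) : ℝ :=
  ∫ w : H × H,
    ‖jointCharFun (F : Measure (H × H)) w.1 w.2
      - charFun ((F : Measure (H × H)).map Prod.fst) w.1
        * charFun ((F : Measure (H × H)).map Prod.snd) w.2‖ ^ 2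
    ∂((ν : Measure H).prod (ν : Measure H))

/-- The alternatives with squared distance covariance at least `ρ`. -/
def alternatives (ν : ProbabilityMeasure H) (ρ : ℝ) : Set (ProbabilityMeasure (H × H)) :=
  {F | ρ ≤ dCovSq ν F}

/-- The empirical joint characteristic functional of the sample `s j = (X_j, Y_j)`. -/
def empJointCharFun {n : ℕ} (s : Fin n → H × H) (w₁ w₂ : H) : ℂ :=
  (1 / (n : ℂ)) * ∑ j, Complex.exp
    (Complex.I * (⟪(s j).1, w₁⟫ : ℝ) + Complex.I * (⟪(s j).2, w₂⟫ : ℝ))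

/-- The empirical characteristic functional of the points `x 0, …, x (n - 1)`. -/
def empCharFun {n : ℕ} (x : Fin n → H) (w : H) : ℂ :=
  (1 / (n : ℂ)) * ∑ j, Complex.exp (Complex.I * (⟪x j, w⟫ : ℝ))

/-- The (squared) empirical distance covariance of the sample `s`. -/
def empDCovSq (ν : ProbabilityMeasure H) {n : ℕ} (s : Fin n → H × H) : ℝ :=
  ∫ w : H × H,
    ‖empJointCharFun s w.1 w.2
      - empCharFun (fun j => (s j).1) w.1 * empCharFun (fun j => (s j).2) w.2‖ ^ 2
    ∂((ν : Measure H).prod (ν : Measure H))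

/-- The characteristic functional of `ν` as a real function; for symmetric `ν` the
characteristic functional is real-valued, so taking the real part loses nothing. -/
def phi (ν : ProbabilityMeasure H) (w : H) : ℝ := (charFun (ν : Measure H) w).re

/-- The doubly centred matrix with entries built from `φ_ν (x k - x l)`. -/
def centred (ν : ProbabilityMeasure H) {n : ℕ} (x : Fin n → H) (k l : Fin n) : ℝ :=
  phi ν (x k - x l)
    - (1 / (n : ℝ)) * ∑ i, phi ν (x i - x l)
    - (1 / (n : ℝ)) * ∑ j, phi ν (x k - x j)
    + (1 / (n : ℝ) ^ 2) * ∑ i, ∑ j, phi ν (x i - x j)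

/-- The permuted empirical distance covariance. -/
def permDCovSq (ν : ProbabilityMeasure H) {n : ℕ} (s : Fin n → H × H)
    (π : Equiv.Perm (Fin n)) : ℝ :=
  (1 / (n : ℝ) ^ 2) * ∑ k, ∑ l,
    centred ν (fun j => (s j).1) k l * centred ν (fun j => (s j).2) (π k) (π l)

/-- The permutation independence test: it takes the value `1` (rejection) if the proportion of
the permuted statistics that are exceeded by the original statistic is larger than `1 - α`. -/
def permTest (α : ℝ) {n B : ℕ} (ν : ProbabilityMeasure H) (s : Fin n → H × H)
    (π : Fin B → Equiv.Perm (Fin n)) : ℕ :=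
  if (1 / (B : ℝ)) * ∑ b, (if empDCovSq ν s > permDCovSq ν s (π b) then (1 : ℝ) else 0) > 1 - α
  then 1 else 0

instance permMeasurableSpace (n : ℕ) : MeasurableSpace (Equiv.Perm (Fin n)) := ⊤

/-- The joint law of the data and the random permutations: `n` i.i.d. observations from `F` and,
independently of them, `B` i.i.d. uniform random permutations of the indices. -/
def jointLaw (F : ProbabilityMeasure (H × H)) (n B : ℕ) :
    Measure ((Fin n → H × H) × (Fin B → Equiv.Perm (Fin n))) :=
  (Measure.pi fun _ : Fin n => (F : Measure (H × H))).prod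
    (Measure.pi fun _ : Fin B => (PMF.uniformOfFintype (Equiv.Perm (Fin n))).toMeasure)

/-- The type-II error `P_F(ψ_ν = 0)` of a family of tests at the reference measure `ν`. -/
def typeIIError {n B : ℕ}
    (ψ : ProbabilityMeasure H → (Fin n → H × H) → (Fin B → Equiv.Perm (Fin n)) → ℕ)
    (ν : ProbabilityMeasure H) (F : ProbabilityMeasure (H × H)) : ℝ≥0∞ :=
  jointLaw F n B {ω | ψ ν ω.1 ω.2 = 0}

/-- The uniform separation rate: the infimum of the `ρ > 0` such that the supremum of the type-II
error over all reference measures `ν` and all alternatives with `dCovSq ν F ≥ ρ` is at most `β`.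
It is taken in `[0, ∞]`, so that it is `∞` if there is no such `ρ`. -/
def uniformSeparationRate {n B : ℕ}
    (ψ : ProbabilityMeasure H → (Fin n → H × H) → (Fin B → Equiv.Perm (Fin n)) → ℕ)
    (β : ℝ) : ℝ≥0∞ :=
  sInf {r : ℝ≥0∞ | ∃ ρ : ℝ, 0 < ρ ∧ r = ENNReal.ofReal ρ ∧
    (⨆ ν ∈ referenceMeasures H, ⨆ F ∈ alternatives ν ρ, typeIIError ψ ν F) ≤ ENNReal.ofReal β}

end DistCov

end

/-!
The test compares `empDCovSq` with permuted statistics, so it suffices to place a deterministic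
threshold `τ` between them: with high probability `empDCovSq ≥ τ`, while conditionally on the data
a permuted statistic exceeds `τ` with probability at most `α / 2`.

*Lower bound for `empDCovSq`.* Write `T = φ_{X,Y} - φ_X φ_Y`. The mean of its empirical
counterpart is `(1 - 1 / n) T` (`integral_empDiff`), so Jensen's inequality shows that the mean of
`empDCovSq` is at least `dCovSq - 8 / n` (`dCovSq_sub_le_integral_empDCovSq`). Changing one
observation changes `empDCovSq` by at most `24 / n`, and McDiarmid's inequality
(`hasSubgaussianMGF_of_boundedDifferences`) controls the deviation from the mean at the scale
`n ^ (-1 / 2)`.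

*Upper bound for `permDCovSq`.* The centred matrices have bounded entries and vanishing row sums,
so by exchangeability the mean over a uniform permutation is at most `32 / n`
(`integral_quadraticForm_le`). Composition with a transposition changes the statistic by at most
`128 / n`, and Maurey's inequality for the symmetric group (`hasSubgaussianMGF_uniformPerm`) gives
a deviation of order `n ^ (-1 / 2)` with a Gaussian tail. This exponential tail is what makes the
rate depend on `α` only through `log α⁻¹`.

*Monte Carlo.* Given the data, the permuted statistics are i.i.d., so by Hoeffding's inequality
(`measureReal_le_card_le`) the proportion above `τ` reaches `α` with probability at most
`exp (-B α ^ 2 / 2) ≤ β / 6`.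

Both concentration inequalities for functions of many variables follow by induction on the number
of variables from one martingale step on a product space (`hasSubgaussianMGF_prod`).
-/

noncomputable section

namespace DistCov

open ProbabilityTheory
open scoped NNReal

/-! ### Bounded-difference inequalities -/

section BoundedDifferences

variable {X Y : Type*} [MeasurableSpace X] [MeasurableSpace Y]

/-- Hoeffding's lemma, with the range of the variable controlled through its oscillation. -/
lemma hasSubgaussianMGF_of_oscillation {μ : Measure X} [IsProbabilityMeasure μ] {f : X → ℝ}
    (hf : Measurable f) {c : ℝ≥0} (hc : ∀ x y, f x - f y ≤ c) :
    HasSubgaussianMGF (fun x => f x - μ[f]) ((c / 2) ^ 2) μ := by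
  obtain ⟨x₀⟩ : Nonempty X := nonempty_of_isProbabilityMeasure μ
  have hbdd : BddBelow (Set.range f) := by
    refine ⟨f x₀ - c, ?_⟩
    rintro _ ⟨y, rfl⟩
    linarith [hc x₀ y]
  have : Nonempty X := ⟨x₀⟩
  have h := hasSubgaussianMGF_of_mem_Icc (μ := μ) (X := f) (a := ⨅ x, f x) (b := (⨅ x, f x) + c)
    hf.aemeasurable (Filter.Eventually.of_forall fun x => ⟨ciInf_le hbdd x, ?_⟩)
  · simpa using h
  · have : f x - c ≤ ⨅ x, f x := le_ciInf fun y => by linarith [hc x y]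
    linarith

/-- The martingale step behind the bounded-difference inequalities: if all the sections of `f`
over `X` are sub-Gaussian with parameter `a`, and the section means oscillate by at most `c`, then
`f` is sub-Gaussian with parameter `(c / 2) ^ 2 + a`. -/
lemma hasSubgaussianMGF_prod {μ : Measure X} {ν : Measure Y} [IsProbabilityMeasure μ]
    [IsProbabilityMeasure ν] {f : X × Y → ℝ} (hf : Measurable f) {M : ℝ} (hM : ∀ z, |f z| ≤ M)
    {a c : ℝ≥0}
    (hfib : ∀ x, HasSubgaussianMGF (fun y => f (x, y) - ∫ y', f (x, y') ∂ν) a ν)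
    (hc : ∀ x x', ∫ y, f (x, y) ∂ν - ∫ y, f (x', y) ∂ν ≤ c) :
    HasSubgaussianMGF (fun z => f z - ∫ z', f z' ∂(μ.prod ν)) ((c / 2) ^ 2 + a) (μ.prod ν) := by
  set g : X → ℝ := fun x => ∫ y, f (x, y) ∂ν with hg
  have hgm : Measurable g := hf.stronglyMeasurable.integral_prod_right'.measurable
  have hint : Integrable f (μ.prod ν) :=
    Integrable.of_bound hf.aestronglyMeasurable M (Filter.Eventually.of_forall hM)
  have hm : ∫ z', f z' ∂(μ.prod ν) = ∫ x, g x ∂μ := integral_prod _ hint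
  rw [hm]
  have h1 := hasSubgaussianMGF_of_oscillation (μ := μ) hgm hc
  have hexp : ∀ t : ℝ, Integrable (fun z => Real.exp (t * (f z - ∫ x, g x ∂μ))) (μ.prod ν) := by
    intro t
    refine integrable_exp_mul_of_mem_Icc (a := -M - ∫ x, g x ∂μ) (b := M - ∫ x, g x ∂μ)
      (by fun_prop) (Filter.Eventually.of_forall fun z => ?_)
    have := abs_le.1 (hM z)
    constructor <;> linarith
  refine ⟨hexp, fun t => ?_⟩
  rw [mgf, integral_prod _ (hexp t)]
  have hbound : ∀ x, ∫ y, Real.exp (t * (f (x, y) - ∫ x, g x ∂μ)) ∂ν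
      ≤ Real.exp (a * t ^ 2 / 2) * Real.exp (t * (g x - ∫ x, g x ∂μ)) := by
    intro x
    have : (fun y => Real.exp (t * (f (x, y) - ∫ x, g x ∂μ)))
        = fun y => Real.exp (t * (f (x, y) - g x)) * Real.exp (t * (g x - ∫ x, g x ∂μ)) := by
      ext y
      rw [← Real.exp_add]
      ring_nf
    rw [this, integral_mul_const]
    exact mul_le_mul_of_nonneg_right ((hfib x).mgf_le t) (Real.exp_nonneg _)
  calc ∫ x, ∫ y, Real.exp (t * (f (x, y) - ∫ x, g x ∂μ)) ∂ν ∂μ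
      ≤ ∫ x, Real.exp (a * t ^ 2 / 2) * Real.exp (t * (g x - ∫ x, g x ∂μ)) ∂μ :=
        integral_mono (hexp t).integral_prod_left ((h1.integrable_exp_mul t).const_mul _) hbound
    _ = Real.exp (a * t ^ 2 / 2) * mgf (fun x => g x - ∫ x, g x ∂μ) μ t := by
        rw [integral_const_mul, mgf]
    _ ≤ Real.exp (a * t ^ 2 / 2) * Real.exp (((c / 2) ^ 2 : ℝ≥0) * t ^ 2 / 2) :=
        mul_le_mul_of_nonneg_left (h1.mgf_le t) (Real.exp_nonneg _)
    _ = Real.exp (((c / 2) ^ 2 + a : ℝ≥0) * t ^ 2 / 2) := by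
        rw [← Real.exp_add]
        push_cast
        ring_nf

/-- Transport of centred sub-Gaussian bounds along a measure-preserving equivalence. -/
lemma hasSubgaussianMGF_of_measurePreserving {μ : Measure X} {ν : Measure Y} {e : X → Y}
    (he : MeasurePreserving e μ ν) {f : Y → ℝ} (hf : Measurable f) {a : ℝ≥0}
    (h : HasSubgaussianMGF (fun y => f y - ∫ y', f y' ∂ν) a ν) :
    HasSubgaussianMGF (fun x => f (e x) - ∫ x', f (e x') ∂μ) a μ := by
  have hi : ∫ x', f (e x') ∂μ = ∫ y', f y' ∂ν := by
    rw [← he.map_eq, integral_map he.measurable.aemeasurable hf.aestronglyMeasurable]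
  rw [hi]
  rw [← he.map_eq] at h
  have := HasSubgaussianMGF.of_map he.measurable.aemeasurable h
  rwa [he.map_eq] at this

/-- **McDiarmid's inequality**, in its moment generating function form: a function of `n` i.i.d.
variables which changes by at most `c` when one variable is changed is sub-Gaussian with parameter
`n * (c / 2) ^ 2` about its mean. -/
lemma hasSubgaussianMGF_of_boundedDifferences {μ : Measure X} [IsProbabilityMeasure μ]
    {c : ℝ≥0} {M : ℝ} : ∀ (n : ℕ) (f : (Fin n → X) → ℝ), Measurable f → (∀ x, |f x| ≤ M) →
    (∀ i x y, (∀ j, j ≠ i → x j = y j) → f x - f y ≤ c) →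
    HasSubgaussianMGF (fun x => f x - ∫ x', f x' ∂(Measure.pi fun _ => μ)) (n * (c / 2) ^ 2)
      (Measure.pi fun _ => μ)
  | 0, f, _, _, _ => by
    have hconst : ∀ x, f x = f default := fun x => congrArg f (Subsingleton.elim _ _)
    simp only [hconst]
    simp
  | n + 1, f, hf, hM, hd => by
    have he := measurePreserving_piFinSuccAbove (fun _ : Fin (n + 1) => μ) 0
    set e := MeasurableEquiv.piFinSuccAbove (fun _ : Fin (n + 1) => X) 0
    have hcons : ∀ p : X × (Fin n → X), e.symm p = Fin.cons p.1 p.2 := fun p => by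
      simp [e, MeasurableEquiv.piFinSuccAbove, Fin.consEquiv]
    have hFm : Measurable fun p => f (e.symm p) := hf.comp e.symm.measurable
    have key : HasSubgaussianMGF (fun p => f (e.symm p)
        - ∫ p', f (e.symm p') ∂(μ.prod (Measure.pi fun _ : Fin n => μ)))
        ((c / 2) ^ 2 + n * (c / 2) ^ 2) (μ.prod (Measure.pi fun _ : Fin n => μ)) := by
      refine hasSubgaussianMGF_prod hFm (fun z => hM _) (fun x => ?_) (fun x x' => ?_)
      · refine hasSubgaussianMGF_of_boundedDifferences n (fun y => f (e.symm (x, y)))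
          (hFm.comp measurable_prodMk_left) (fun y => hM _) (fun i y y' hy => ?_)
        refine hd i.succ _ _ fun j hj => ?_
        simp only [hcons]
        induction j using Fin.cases with
        | zero => simp
        | succ j => simpa using hy j (fun h => hj (by rw [h]))
      · have hi : ∀ x, Integrable (fun y => f (e.symm (x, y))) (Measure.pi fun _ : Fin n => μ) :=
          fun x => Integrable.of_bound (hFm.comp measurable_prodMk_left).aestronglyMeasurable M
            (Filter.Eventually.of_forall fun _ => hM _)
        rw [← integral_sub (hi x) (hi x')]
        calc ∫ y, (f (e.symm (x, y)) - f (e.symm (x', y))) ∂(Measure.pi fun _ : Fin n => μ)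
            ≤ ∫ _, (c : ℝ) ∂(Measure.pi fun _ : Fin n => μ) := by
              refine integral_mono ((hi x).sub (hi x')) (integrable_const _) fun y => ?_
              refine hd 0 _ _ fun j hj => ?_
              simp only [hcons]
              induction j using Fin.cases with
              | zero => exact absurd rfl hj
              | succ j => simp
          _ = c := by simp
    have := hasSubgaussianMGF_of_measurePreserving he hFm key
    simp only [MeasurableEquiv.symm_apply_apply] at this
    convert this using 1
    push_cast
    ring

end BoundedDifferences

/-! ### Concentration for uniform random permutations -/

section Permutations

open Equiv

instance permDiscreteMeasurableSpace (n : ℕ) : DiscreteMeasurableSpace (Perm (Fin n)) :=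
  ⟨fun _ => trivial⟩

/-- The uniform distribution on the permutations of `Fin n`. -/
def uniformPerm (n : ℕ) : Measure (Perm (Fin n)) :=
  (PMF.uniformOfFintype (Perm (Fin n))).toMeasure

instance (n : ℕ) : IsProbabilityMeasure (uniformPerm n) := by
  unfold uniformPerm; infer_instance

lemma uniformPerm_singleton (n : ℕ) (π : Perm (Fin n)) :
    uniformPerm n {π} = ((n.factorial : ℝ≥0∞))⁻¹ := by
  rw [uniformPerm, PMF.toMeasure_apply_singleton _ _ (MeasurableSet.singleton _)]
  simp [Fintype.card_perm]

/-- A uniform permutation of `Fin (n + 1)` consists of a uniform image of `0` and an independent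
uniform permutation of the remaining points. -/
lemma measurePreserving_decomposeFin (n : ℕ) :
    MeasurePreserving (Perm.decomposeFin (n := n)) (uniformPerm (n + 1))
      ((PMF.uniformOfFintype (Fin (n + 1))).toMeasure.prod (uniformPerm n)) := by
  refine ⟨measurable_of_finite _, ?_⟩
  refine Measure.ext_of_singleton fun q => ?_
  obtain ⟨p, e⟩ := q
  rw [Measure.map_apply (measurable_of_finite _) (MeasurableSet.singleton _),
    ← Set.singleton_prod_singleton, Measure.prod_prod, uniformPerm_singleton,
    PMF.toMeasure_apply_singleton _ _ (MeasurableSet.singleton _)]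
  have : Perm.decomposeFin (n := n) ⁻¹' ({p} ×ˢ {e}) = {Perm.decomposeFin.symm (p, e)} := by
    ext π
    simp only [Set.singleton_prod_singleton, Set.mem_preimage, Set.mem_singleton_iff]
    rw [Equiv.eq_symm_apply]
  rw [this, uniformPerm_singleton, Nat.factorial_succ]
  simp only [PMF.uniformOfFintype_apply, Fintype.card_fin]
  rw [Nat.cast_mul, ENNReal.mul_inv (by simp) (by simp)]

lemma decomposeFin_symm_eq_swap_mul {n : ℕ} (p : Fin (n + 1)) (e : Perm (Fin n)) :
    Perm.decomposeFin.symm (p, e) = swap 0 p * Perm.decomposeFin.symm (0, e) := by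
  ext x
  induction x using Fin.cases <;> simp

lemma decomposeFin_symm_swap_mul {n : ℕ} (p : Fin (n + 1)) (i j : Fin n) (e : Perm (Fin n)) :
    Perm.decomposeFin.symm (p, swap i j * e)
      = swap (swap 0 p i.succ) (swap 0 p j.succ) * Perm.decomposeFin.symm (p, e) := by
  ext x
  induction x using Fin.cases with
  | zero =>
    simp only [Perm.decomposeFin_symm_apply_zero, Perm.mul_apply]
    rw [swap_apply_of_ne_of_ne]
    · intro h
      have h' := congrArg (swap 0 p) h
      rw [swap_apply_right, swap_apply_self] at h'
      exact (Fin.succ_ne_zero i) h'.symm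
    · intro h
      have h' := congrArg (swap 0 p) h
      rw [swap_apply_right, swap_apply_self] at h'
      exact (Fin.succ_ne_zero j) h'.symm
  | succ x =>
    simp only [Perm.decomposeFin_symm_apply_succ, Perm.mul_apply]
    rw [← (swap 0 p).injective.map_swap, ← (Fin.succ_injective n).map_swap]

/-- **Maurey's inequality**, in its moment generating function form: a function of a uniform
permutation which changes by at most `c` under composition with a transposition is sub-Gaussian
with parameter `n * c ^ 2` about its mean. -/
lemma hasSubgaussianMGF_uniformPerm {c : ℝ≥0} : ∀ (n : ℕ) (f : Perm (Fin n) → ℝ),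
    (∀ i j π, |f (swap i j * π) - f π| ≤ c) →
    HasSubgaussianMGF (fun π => f π - ∫ π', f π' ∂(uniformPerm n)) (n * c ^ 2) (uniformPerm n)
  | 0, f, _ => by
    have hconst : ∀ x, f x = f default := fun x => congrArg f (Subsingleton.elim _ _)
    simp only [hconst]
    simp
  | n + 1, f, hd => by
    have he := measurePreserving_decomposeFin n
    set e := Perm.decomposeFin (n := n)
    have key : HasSubgaussianMGF (fun p => f (e.symm p)
        - ∫ p', f (e.symm p') ∂((PMF.uniformOfFintype (Fin (n + 1))).toMeasure.prod
          (uniformPerm n)))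
        ((2 * c / 2) ^ 2 + n * c ^ 2)
        ((PMF.uniformOfFintype (Fin (n + 1))).toMeasure.prod (uniformPerm n)) := by
      refine hasSubgaussianMGF_prod (measurable_of_finite _) (M := ∑ π, |f π|)
        (fun z => Finset.single_le_sum (f := fun π => |f π|) (fun _ _ => abs_nonneg _)
          (Finset.mem_univ _)) (fun p => ?_) (fun p q => ?_)
      · refine hasSubgaussianMGF_uniformPerm n (fun π => f (e.symm (p, π))) (fun i j π => ?_)
        simp only [e]
        rw [decomposeFin_symm_swap_mul]
        exact hd _ _ _
      -- Only comparisons with `p = 0` differ by a single transposition; passing through them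
      -- costs a factor two in the oscillation.
      · have hcmp : ∀ p, |∫ π, f (e.symm (p, π)) ∂(uniformPerm n)
            - ∫ π, f (e.symm (0, π)) ∂(uniformPerm n)| ≤ c := by
          intro p
          rw [← integral_sub Integrable.of_finite Integrable.of_finite]
          have := norm_integral_le_of_norm_le_const (μ := uniformPerm n)
            (f := fun π => f (e.symm (p, π)) - f (e.symm (0, π))) (C := c)
            (Filter.Eventually.of_forall fun π => by
              simp only [e, Real.norm_eq_abs]
              rw [decomposeFin_symm_eq_swap_mul p]
              exact hd _ _ _)
          simpa using this
        have h1 := (abs_le.1 (hcmp p)).2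
        have h2 := (abs_le.1 (hcmp q)).1
        push_cast
        linarith
    have := hasSubgaussianMGF_of_measurePreserving he (measurable_of_finite _) key
    simp only [Equiv.symm_apply_apply] at this
    convert this using 1
    push_cast
    rw [mul_div_cancel_left₀ _ (by norm_num)]
    ring

end Permutations

/-! ### Concentration of the empirical distance covariance -/

section Averages

variable {n : ℕ}

lemma norm_average_le_one {u : Fin n → ℂ} (hu : ∀ j, ‖u j‖ ≤ 1) :
    ‖1 / (n : ℂ) * ∑ j, u j‖ ≤ 1 := by
  rcases Nat.eq_zero_or_pos n with rfl | hn
  · simp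
  have h : ‖∑ j, u j‖ ≤ n := (norm_sum_le _ _).trans
    ((Finset.sum_le_sum fun j _ => hu j).trans (by simp))
  have hn' : (0 : ℝ) < n := by exact_mod_cast hn
  rw [norm_mul, norm_div, norm_one, Complex.norm_natCast, one_div, inv_mul_le_iff₀ hn']
  simpa using h

lemma norm_average_sub_average_le {u v : Fin n → ℂ} (hu : ∀ j, ‖u j‖ ≤ 1) (hv : ∀ j, ‖v j‖ ≤ 1)
    {i : Fin n} (h : ∀ j, j ≠ i → u j = v j) :
    ‖1 / (n : ℂ) * ∑ j, u j - 1 / (n : ℂ) * ∑ j, v j‖ ≤ 2 / n := by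
  have hs : ∑ j, u j - ∑ j, v j = u i - v i := by
    rw [← Finset.sum_sub_distrib]
    exact Finset.sum_eq_single i (fun j _ hj => by rw [h j hj, sub_self]) (by simp)
  rw [← mul_sub, hs, norm_mul, norm_div, norm_one, Complex.norm_natCast, one_div, div_eq_inv_mul]
  refine mul_le_mul_of_nonneg_left ?_ (by positivity)
  exact (norm_sub_le _ _).trans (by linarith [hu i, hv i])

end Averages

/-- Functions of two different coordinates of an i.i.d. sample are uncorrelated. -/
lemma integral_mul_eval {E : Type*} [MeasurableSpace E] {μ : Measure E} [IsProbabilityMeasure μ]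
    {n : ℕ} {u v : E → ℂ} (hu : Measurable u) (hv : Measurable v) {j k : Fin n} (hjk : j ≠ k) :
    ∫ s, u (s j) * v (s k) ∂(Measure.pi fun _ : Fin n => μ) = (∫ z, u z ∂μ) * ∫ z, v z ∂μ := by
  have hind : iIndepFun (fun i (s : Fin n → E) => s i) (Measure.pi fun _ : Fin n => μ) :=
    iIndepFun_pi (X := fun _ z => z) fun _ => aemeasurable_id
  have h2 := ((hind.indepFun hjk).comp hu hv).integral_fun_mul_eq_mul_integral
    (hu.comp (measurable_pi_apply j)).aestronglyMeasurable
    (hv.comp (measurable_pi_apply k)).aestronglyMeasurable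
  simp only [Function.comp_apply] at h2
  rw [h2, integral_comp_eval (μ := fun _ : Fin n => μ) hu.aestronglyMeasurable,
    integral_comp_eval (μ := fun _ : Fin n => μ) hv.aestronglyMeasurable]

lemma integrable_of_continuous_of_norm_le {Ω : Type*} [TopologicalSpace Ω] [MeasurableSpace Ω]
    [OpensMeasurableSpace Ω] {μ : Measure Ω} [IsFiniteMeasure μ] {f : Ω → ℂ}
    (hf : Continuous f) {C : ℝ} (hC : ∀ x, ‖f x‖ ≤ C) : Integrable f μ :=
  Integrable.of_bound hf.measurable.aestronglyMeasurable C (Filter.Eventually.of_forall hC)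

lemma sq_norm_integral_le {Ω : Type*} [MeasurableSpace Ω] {μ : Measure Ω} [IsProbabilityMeasure μ]
    {f : Ω → ℂ} (hf : AEStronglyMeasurable f μ) {C : ℝ} (hC : ∀ x, ‖f x‖ ≤ C) :
    ‖∫ x, f x ∂μ‖ ^ 2 ≤ ∫ x, ‖f x‖ ^ 2 ∂μ := by
  have hL : MemLp (fun x => ‖f x‖) 2 μ :=
    MemLp.of_bound hf.norm C (Filter.Eventually.of_forall fun x => by simpa using hC x)
  have hv := variance_nonneg (fun x => ‖f x‖) μ
  rw [variance_eq_sub hL] at hv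
  have h1 : ‖∫ x, f x ∂μ‖ ^ 2 ≤ (∫ x, ‖f x‖ ∂μ) ^ 2 :=
    pow_le_pow_left₀ (norm_nonneg _) (norm_integral_le_integral_norm f) 2
  simp only [Pi.pow_apply] at hv
  linarith

section EmpiricalDistanceCovariance

variable {H : Type*} [NormedAddCommGroup H] [InnerProductSpace ℝ H]

lemma norm_exp_I_mul_ofReal (a : ℝ) : ‖Complex.exp (Complex.I * (a : ℝ))‖ = 1 := by
  rw [mul_comm, Complex.norm_exp_ofReal_mul_I]

lemma norm_exp_I_mul_ofReal_add (a b : ℝ) :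
    ‖Complex.exp (Complex.I * (a : ℝ) + Complex.I * (b : ℝ))‖ = 1 := by
  rw [Complex.exp_add, norm_mul, norm_exp_I_mul_ofReal, norm_exp_I_mul_ofReal, one_mul]

/-- The empirical counterpart of the difference `φ_{X,Y} - φ_X φ_Y`. -/
def empDiff {n : ℕ} (s : Fin n → H × H) (w : H × H) : ℂ :=
  empJointCharFun s w.1 w.2
    - empCharFun (fun j => (s j).1) w.1 * empCharFun (fun j => (s j).2) w.2

section

variable {n : ℕ}

lemma norm_empCharFun_le (x : Fin n → H) (w : H) : ‖empCharFun x w‖ ≤ 1 :=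
  norm_average_le_one fun _ => (norm_exp_I_mul_ofReal _).le

lemma norm_empJointCharFun_le (s : Fin n → H × H) (w₁ w₂ : H) : ‖empJointCharFun s w₁ w₂‖ ≤ 1 :=
  norm_average_le_one fun _ => (norm_exp_I_mul_ofReal_add _ _).le

lemma norm_sub_mul_le_two {a b c : ℂ} (ha : ‖a‖ ≤ 1) (hb : ‖b‖ ≤ 1) (hc : ‖c‖ ≤ 1) :
    ‖a - b * c‖ ≤ 2 := by
  have h : ‖b * c‖ ≤ 1 := by
    rw [norm_mul]
    exact mul_le_one₀ hb (norm_nonneg _) hc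
  exact (norm_sub_le _ _).trans (by linarith)

lemma norm_empDiff_le (s : Fin n → H × H) (w : H × H) : ‖empDiff s w‖ ≤ 2 :=
  norm_sub_mul_le_two (norm_empJointCharFun_le _ _ _) (norm_empCharFun_le _ _)
    (norm_empCharFun_le _ _)

lemma sq_norm_empDiff_le (s : Fin n → H × H) (w : H × H) : ‖empDiff s w‖ ^ 2 ≤ 4 := by
  have := norm_empDiff_le s w
  nlinarith [norm_nonneg (empDiff s w)]

lemma norm_empDiff_sub_le {s s' : Fin n → H × H} {i : Fin n} (h : ∀ j, j ≠ i → s j = s' j)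
    (w : H × H) : ‖empDiff s w - empDiff s' w‖ ≤ 6 / n := by
  have h1 : ‖empJointCharFun s w.1 w.2 - empJointCharFun s' w.1 w.2‖ ≤ 2 / n :=
    norm_average_sub_average_le (fun _ => (norm_exp_I_mul_ofReal_add _ _).le)
      (fun _ => (norm_exp_I_mul_ofReal_add _ _).le) (i := i) fun j hj => by rw [h j hj]
  have h2 : ‖empCharFun (fun j => (s j).1) w.1 - empCharFun (fun j => (s' j).1) w.1‖ ≤ 2 / n :=
    norm_average_sub_average_le (fun _ => (norm_exp_I_mul_ofReal _).le)
      (fun _ => (norm_exp_I_mul_ofReal _).le) (i := i) fun j hj => by simp only [h j hj]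
  have h3 : ‖empCharFun (fun j => (s j).2) w.2 - empCharFun (fun j => (s' j).2) w.2‖ ≤ 2 / n :=
    norm_average_sub_average_le (fun _ => (norm_exp_I_mul_ofReal _).le)
      (fun _ => (norm_exp_I_mul_ofReal _).le) (i := i) fun j hj => by simp only [h j hj]
  have e : empDiff s w - empDiff s' w
      = (empJointCharFun s w.1 w.2 - empJointCharFun s' w.1 w.2)
        - (empCharFun (fun j => (s j).1) w.1 - empCharFun (fun j => (s' j).1) w.1)
          * empCharFun (fun j => (s j).2) w.2
        - empCharFun (fun j => (s' j).1) w.1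
          * (empCharFun (fun j => (s j).2) w.2 - empCharFun (fun j => (s' j).2) w.2) := by
    unfold empDiff
    ring
  have h4 : ‖(empCharFun (fun j => (s j).1) w.1 - empCharFun (fun j => (s' j).1) w.1)
      * empCharFun (fun j => (s j).2) w.2‖ ≤ 2 / n := by
    rw [norm_mul]
    exact (mul_le_of_le_one_right (norm_nonneg _) (norm_empCharFun_le _ _)).trans h2
  have h5 : ‖empCharFun (fun j => (s' j).1) w.1
      * (empCharFun (fun j => (s j).2) w.2 - empCharFun (fun j => (s' j).2) w.2)‖ ≤ 2 / n := by
    rw [norm_mul]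
    exact (mul_le_of_le_one_left (norm_nonneg _) (norm_empCharFun_le _ _)).trans h3
  rw [e]
  calc _ ≤ 2 / n + 2 / n + 2 / (n : ℝ) :=
        (norm_sub_le _ _).trans (add_le_add ((norm_sub_le _ _).trans (add_le_add h1 h4)) h5)
    _ = 6 / n := by ring

lemma sq_norm_empDiff_sub_le {s s' : Fin n → H × H} {i : Fin n} (h : ∀ j, j ≠ i → s j = s' j)
    (w : H × H) : ‖empDiff s w‖ ^ 2 - ‖empDiff s' w‖ ^ 2 ≤ 24 / n := by
  have h1 := norm_empDiff_sub_le h w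
  have h2 := norm_sub_norm_le (empDiff s w) (empDiff s' w)
  have h3 := norm_empDiff_le s w
  have h4 := norm_empDiff_le s' w
  have h5 : (0 : ℝ) ≤ 6 / n := by positivity
  have e : (24 : ℝ) / n = 6 / n * 4 := by ring
  rw [e]
  calc ‖empDiff s w‖ ^ 2 - ‖empDiff s' w‖ ^ 2
      = (‖empDiff s w‖ - ‖empDiff s' w‖) * (‖empDiff s w‖ + ‖empDiff s' w‖) := by ring
    _ ≤ 6 / n * (‖empDiff s w‖ + ‖empDiff s' w‖) :=
        mul_le_mul_of_nonneg_right (h2.trans h1) (by positivity)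
    _ ≤ 6 / n * 4 := mul_le_mul_of_nonneg_left (by linarith) h5

lemma continuous_empDiff : Continuous fun p : (Fin n → H × H) × (H × H) => empDiff p.1 p.2 := by
  unfold empDiff empJointCharFun empCharFun
  fun_prop

end

variable [MeasurableSpace H]

lemma empDCovSq_eq {n : ℕ} (ν : ProbabilityMeasure H) (s : Fin n → H × H) : empDCovSq ν s
    = ∫ w, ‖empDiff s w‖ ^ 2 ∂((ν : Measure H).prod (ν : Measure H)) := rfl

lemma abs_empDCovSq_le {n : ℕ} (ν : ProbabilityMeasure H) (s : Fin n → H × H) :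
    |empDCovSq ν s| ≤ 4 := by
  have := norm_integral_le_of_norm_le_const (μ := (ν : Measure H).prod (ν : Measure H))
    (f := fun w => ‖empDiff s w‖ ^ 2) (C := 4) (Filter.Eventually.of_forall fun w => by
      rw [Real.norm_of_nonneg (by positivity)]
      exact sq_norm_empDiff_le s w)
  simpa [empDCovSq_eq] using this

lemma norm_jointCharFun_sub_le (F : ProbabilityMeasure (H × H)) (w : H × H) :
    ‖jointCharFun (F : Measure (H × H)) w.1 w.2
    - charFun ((F : Measure (H × H)).map Prod.fst) w.1
      * charFun ((F : Measure (H × H)).map Prod.snd) w.2‖ ≤ 2 := by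
  have h1 : IsProbabilityMeasure ((F : Measure (H × H)).map Prod.fst) :=
    Measure.isProbabilityMeasure_map measurable_fst.aemeasurable
  have h2 : IsProbabilityMeasure ((F : Measure (H × H)).map Prod.snd) :=
    Measure.isProbabilityMeasure_map measurable_snd.aemeasurable
  refine norm_sub_mul_le_two ?_ (norm_charFun_le_one _) (norm_charFun_le_one _)
  have := norm_integral_le_of_norm_le_const (μ := (F : Measure (H × H))) (C := 1)
    (f := fun z : H × H => Complex.exp (Complex.I * (⟪z.1, w.1⟫ : ℝ)
      + Complex.I * (⟪z.2, w.2⟫ : ℝ)))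
    (Filter.Eventually.of_forall fun z => (norm_exp_I_mul_ofReal_add _ _).le)
  simpa [jointCharFun] using this

variable [BorelSpace H]

lemma charFun_map_fst (F : ProbabilityMeasure (H × H)) (w : H) :
    charFun ((F : Measure (H × H)).map Prod.fst) w
    = ∫ z, Complex.exp (Complex.I * (⟪z.1, w⟫ : ℝ)) ∂(F : Measure (H × H)) := by
  rw [charFun_apply, integral_map measurable_fst.aemeasurable
    (Continuous.aestronglyMeasurable (by fun_prop))]
  simp_rw [mul_comm Complex.I]

lemma charFun_map_snd (F : ProbabilityMeasure (H × H)) (w : H) :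
    charFun ((F : Measure (H × H)).map Prod.snd) w
    = ∫ z, Complex.exp (Complex.I * (⟪z.2, w⟫ : ℝ)) ∂(F : Measure (H × H)) := by
  rw [charFun_apply, integral_map measurable_snd.aemeasurable
    (Continuous.aestronglyMeasurable (by fun_prop))]
  simp_rw [mul_comm Complex.I]

variable [SecondCountableTopology H]

section

variable {n : ℕ} (ν : ProbabilityMeasure H)

lemma integrable_sq_norm_empDiff (s : Fin n → H × H) :
    Integrable (fun w => ‖empDiff s w‖ ^ 2) ((ν : Measure H).prod (ν : Measure H)) := by
  refine Integrable.of_bound (C := 4) (Continuous.aestronglyMeasurable ?_)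
    (Filter.Eventually.of_forall fun w => ?_)
  · exact (continuous_empDiff.comp (Continuous.prodMk_right s)).norm.pow 2
  · rw [Real.norm_of_nonneg (by positivity)]
    exact sq_norm_empDiff_le s w

lemma measurable_empDCovSq : Measurable fun s : Fin n → H × H => empDCovSq ν s := by
  have h : Continuous fun p : (Fin n → H × H) × (H × H) => ‖empDiff p.1 p.2‖ ^ 2 :=
    continuous_empDiff.norm.pow 2
  exact (h.stronglyMeasurable.integral_prod_right'
    (ν := (ν : Measure H).prod (ν : Measure H))).measurable

lemma empDCovSq_sub_le {s s' : Fin n → H × H} {i : Fin n} (h : ∀ j, j ≠ i → s j = s' j) :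
    empDCovSq ν s - empDCovSq ν s' ≤ 24 / n := by
  rw [empDCovSq_eq, empDCovSq_eq,
    ← integral_sub (integrable_sq_norm_empDiff ν s) (integrable_sq_norm_empDiff ν s')]
  calc _ ≤ ∫ _, (24 / n : ℝ) ∂((ν : Measure H).prod (ν : Measure H)) :=
        integral_mono ((integrable_sq_norm_empDiff ν s).sub (integrable_sq_norm_empDiff ν s'))
          (integrable_const _) fun w => sq_norm_empDiff_sub_le h w
    _ = 24 / n := by simp

end

section Mean

variable {n : ℕ} (F : ProbabilityMeasure (H × H))

/-- The pairs with equal indices in the product of the two empirical characteristic functionals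
reproduce the joint one, so the expectation is the population difference up to a factor. -/
lemma integral_empDiff (hn : n ≠ 0) (w : H × H) :
    ∫ s, empDiff s w ∂(Measure.pi fun _ : Fin n => (F : Measure (H × H)))
      = (1 - 1 / (n : ℂ)) * (jointCharFun (F : Measure (H × H)) w.1 w.2
        - charFun ((F : Measure (H × H)).map Prod.fst) w.1
          * charFun ((F : Measure (H × H)).map Prod.snd) w.2) := by
  set P := Measure.pi fun _ : Fin n => (F : Measure (H × H)) with hP
  set u : H × H → ℂ := fun z => Complex.exp (Complex.I * (⟪z.1, w.1⟫ : ℝ)) with hu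
  set v : H × H → ℂ := fun z => Complex.exp (Complex.I * (⟪z.2, w.2⟫ : ℝ)) with hv
  have huc : Continuous u := by fun_prop
  have hvc : Continuous v := by fun_prop
  have hu1 : ∀ z, ‖u z‖ = 1 := fun z => norm_exp_I_mul_ofReal _
  have hv1 : ∀ z, ‖v z‖ = 1 := fun z => norm_exp_I_mul_ofReal _
  have hT : jointCharFun (F : Measure (H × H)) w.1 w.2 = ∫ z, u z * v z ∂(F : Measure (H × H)) := by
    simp only [jointCharFun, hu, hv, Complex.exp_add]
  have hint : ∀ j k : Fin n, Integrable (fun s : Fin n → H × H => u (s j) * v (s k)) P :=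
    fun j k => integrable_of_continuous_of_norm_le (C := 1) (by fun_prop) fun s => by
      simp [hu1, hv1]
  have hdiag : ∀ j : Fin n, ∫ s, u (s j) * v (s j) ∂P = ∫ z, u z * v z ∂(F : Measure (H × H)) :=
    fun j => integral_comp_eval (μ := fun _ : Fin n => (F : Measure (H × H)))
      (f := fun z => u z * v z) (huc.mul hvc).measurable.aestronglyMeasurable
  have hexp : ∀ s : Fin n → H × H, empDiff s w
      = 1 / (n : ℂ) * ∑ j, u (s j) * v (s j)
        - 1 / (n : ℂ) ^ 2 * ∑ j, ∑ k, u (s j) * v (s k) := by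
    intro s
    simp only [empDiff, empJointCharFun, empCharFun, hu, hv, Complex.exp_add]
    rw [← Finset.sum_mul_sum]
    ring
  have hn' : (n : ℂ) ≠ 0 := by exact_mod_cast hn
  have hsum : ∀ j : Fin n, ∑ k, ∫ s, u (s j) * v (s k) ∂P
      = (∫ z, u z * v z ∂(F : Measure (H × H)))
        + (n - 1) * ((∫ z, u z ∂(F : Measure (H × H))) * ∫ z, v z ∂(F : Measure (H × H))) := by
    intro j
    rw [← Finset.add_sum_erase _ _ (Finset.mem_univ j), hdiag]
    congr 1
    rw [Finset.sum_congr rfl fun k hk =>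
      integral_mul_eval huc.measurable hvc.measurable (Finset.ne_of_mem_erase hk).symm]
    rw [Finset.sum_const, Finset.card_erase_of_mem (Finset.mem_univ _), Finset.card_univ,
      Fintype.card_fin, nsmul_eq_mul, Nat.cast_sub (Nat.one_le_iff_ne_zero.2 hn), Nat.cast_one]
  simp only [hexp]
  rw [integral_sub ((integrable_finsetSum _ fun j _ => hint j j).const_mul _)
    ((integrable_finsetSum _ fun j _ => integrable_finsetSum _ fun k _ => hint j k).const_mul _),
    integral_const_mul, integral_const_mul, integral_finsetSum _ fun j _ => hint j j,
    integral_finsetSum _ fun j _ => integrable_finsetSum _ fun k _ => hint j k]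
  simp_rw [integral_finsetSum _ fun k _ => hint _ k, hsum, hdiag]
  rw [charFun_map_fst, charFun_map_snd, hT]
  simp only [Finset.sum_const, Finset.card_univ, Fintype.card_fin, nsmul_eq_mul]
  field_simp
  ring

/-- The empirical distance covariance underestimates by at most `8 / n` on average. By Jensen's
inequality its mean is at least the integral of the squared modulus of the mean difference. -/
lemma dCovSq_sub_le_integral_empDCovSq (hn : n ≠ 0) (ν : ProbabilityMeasure H) :
    dCovSq ν F - 8 / n
      ≤ ∫ s, empDCovSq ν s ∂(Measure.pi fun _ : Fin n => (F : Measure (H × H))) := by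
  set P := Measure.pi fun _ : Fin n => (F : Measure (H × H)) with hP
  set Q := (ν : Measure H).prod (ν : Measure H) with hQ
  have hcont : Continuous fun p : (Fin n → H × H) × (H × H) => ‖empDiff p.1 p.2‖ ^ 2 :=
    continuous_empDiff.norm.pow 2
  have hint : Integrable (fun p : (Fin n → H × H) × (H × H) => ‖empDiff p.1 p.2‖ ^ 2)
      (P.prod Q) :=
    Integrable.of_bound hcont.aestronglyMeasurable 4 (Filter.Eventually.of_forall fun p => by
      rw [Real.norm_of_nonneg (by positivity)]
      exact sq_norm_empDiff_le _ _)
  have hswap : ∫ s, empDCovSq ν s ∂P = ∫ w, ∫ s, ‖empDiff s w‖ ^ 2 ∂P ∂Q :=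
    integral_integral_swap hint
  have hgi : Integrable (fun w => (∫ s, ‖empDiff s w‖ ^ 2 ∂P) + 8 / n) Q :=
    hint.integral_prod_right.add (integrable_const _)
  have hn1 : (1 : ℝ) ≤ n := by exact_mod_cast Nat.one_le_iff_ne_zero.2 hn
  have hpt : ∀ w : H × H, ‖jointCharFun (F : Measure (H × H)) w.1 w.2
      - charFun ((F : Measure (H × H)).map Prod.fst) w.1
        * charFun ((F : Measure (H × H)).map Prod.snd) w.2‖ ^ 2
      ≤ (∫ s, ‖empDiff s w‖ ^ 2 ∂P) + 8 / n := by
    intro w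
    have h1 := sq_norm_integral_le (μ := P) (f := fun s => empDiff s w) (C := 2)
      (continuous_empDiff.comp (Continuous.prodMk_left w)).measurable.aestronglyMeasurable
      (fun s => norm_empDiff_le s w)
    rw [integral_empDiff F hn w, norm_mul] at h1
    have h2 := norm_jointCharFun_sub_le F w
    set T := ‖jointCharFun (F : Measure (H × H)) w.1 w.2
      - charFun ((F : Measure (H × H)).map Prod.fst) w.1
        * charFun ((F : Measure (H × H)).map Prod.snd) w.2‖ with hTdef
    have hT0 : 0 ≤ T := norm_nonneg _
    have h3 : ‖(1 - 1 / (n : ℂ))‖ = 1 - 1 / n := by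
      have : (1 - 1 / (n : ℂ)) = ((1 - 1 / n : ℝ) : ℂ) := by push_cast; ring
      rw [this, Complex.norm_real, Real.norm_of_nonneg]
      rw [sub_nonneg, div_le_one (by linarith)]
      exact hn1
    rw [h3, mul_pow] at h1
    have h4 : (8 : ℝ) / n = 2 * (1 / n) * 4 := by ring
    have h5 : 0 ≤ 1 / (n : ℝ) := by positivity
    have h6 : T ^ 2 ≤ 4 := by nlinarith
    rw [h4]
    nlinarith [mul_nonneg h5 (sub_nonneg.2 h6), mul_nonneg (sq_nonneg (1 / (n : ℝ))) (sq_nonneg T)]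
  have := integral_mono_of_nonneg (μ := Q) (Filter.Eventually.of_forall fun w => by positivity)
    hgi (Filter.Eventually.of_forall hpt)
  rw [integral_add hint.integral_prod_right (integrable_const _)] at this
  rw [hswap, sub_le_iff_le_add]
  simpa [dCovSq] using this

/-- Lower-tail bound for the empirical distance covariance. -/
lemma measureReal_empDCovSq_le (hn : n ≠ 0) (ν : ProbabilityMeasure H) {t : ℝ} (ht : 0 ≤ t) :
    (Measure.pi fun _ : Fin n => (F : Measure (H × H))).real
      {s | empDCovSq ν s ≤ dCovSq ν F - 8 / n - t} ≤ Real.exp (-(n * t ^ 2 / 288)) := by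
  have hn1 : (0 : ℝ) < n := by exact_mod_cast Nat.pos_of_ne_zero hn
  have h := (hasSubgaussianMGF_of_boundedDifferences (μ := (F : Measure (H × H)))
    (c := 24 / n) (M := 4) n (fun s => empDCovSq ν s) (measurable_empDCovSq ν)
    (abs_empDCovSq_le ν) (fun i x y hxy => by
      simpa using empDCovSq_sub_le ν hxy)).neg.measure_ge_le ht
  refine (measureReal_mono ?_).trans (h.trans (le_of_eq ?_))
  · intro s hs
    have := dCovSq_sub_le_integral_empDCovSq F hn ν
    simp only [Set.mem_ofPred_eq, Pi.neg_apply] at hs ⊢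
    linarith
  · congr 1
    push_cast
    field_simp
    ring

end Mean

end EmpiricalDistanceCovariance

/-! ### Permuted quadratic forms -/

section QuadraticForms

open Equiv

variable {n : ℕ}

lemma integral_uniformPerm_mul_right (σ : Perm (Fin n)) (f : Perm (Fin n) → ℝ) :
    ∫ π, f (π * σ) ∂(uniformPerm n) = ∫ π, f π ∂(uniformPerm n) := by
  have h : (uniformPerm n).map (fun π => π * σ) = uniformPerm n := by
    refine Measure.ext_of_singleton fun π => ?_
    rw [Measure.map_apply (measurable_of_finite _) (MeasurableSet.singleton _)]
    have : (fun π => π * σ) ⁻¹' {π} = {π * σ⁻¹} := by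
      ext τ
      simp [eq_mul_inv_iff_mul_eq]
    rw [this, uniformPerm_singleton, uniformPerm_singleton]
  conv_rhs => rw [← h]
  rw [integral_map (measurable_of_finite _).aemeasurable
    (measurable_of_finite _).aestronglyMeasurable]

/-- If the rows of `W` sum to zero, then by exchangeability the off-diagonal entries of the mean
permuted matrix all equal the negative of its diagonal entry divided by `n - 1`, hence its rows
have absolute sums bounded independently of `n`. -/
lemma sum_abs_integral_uniformPerm_le {W : Fin n → Fin n → ℝ} {K : ℝ} (hW : ∀ i j, |W i j| ≤ K)
    (hrow : ∀ i, ∑ j, W i j = 0) (k : Fin n) :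
    ∑ l, |∫ π, W (π k) (π l) ∂(uniformPerm n)| ≤ 2 * K := by
  set A : Fin n → ℝ := fun l => ∫ π, W (π k) (π l) ∂(uniformPerm n) with hA
  have hkk : |A k| ≤ K := by
    have := norm_integral_le_of_norm_le_const (μ := uniformPerm n) (C := K)
      (f := fun π => W (π k) (π k)) (Filter.Eventually.of_forall fun π => hW _ _)
    simpa [hA] using this
  have hsum : ∑ l, A l = 0 := by
    rw [← integral_finsetSum _ fun l _ => Integrable.of_finite]
    have : ∀ π : Perm (Fin n), ∑ l, W (π k) (π l) = 0 := fun π => by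
      rw [Equiv.sum_comp π (fun l => W (π k) l), hrow]
    simp [this]
  have hoff : ∀ l, l ≠ k → ∀ l', l' ≠ k → A l = A l' := by
    intro l hl l' hl'
    have := integral_uniformPerm_mul_right (swap l l') (fun π => W (π k) (π l))
    simp only [Perm.mul_apply, swap_apply_left, swap_apply_of_ne_of_ne hl.symm hl'.symm] at this
    exact this.symm
  have hsplit : ∑ l, |A l| = |A k| + |∑ l ∈ Finset.univ.erase k, A l| := by
    rw [← Finset.add_sum_erase _ _ (Finset.mem_univ k)]
    congr 1
    rcases (Finset.univ.erase k).eq_empty_or_nonempty with h | ⟨l₀, hl₀⟩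
    · simp [h]
    · have h0 := Finset.ne_of_mem_erase hl₀
      rw [Finset.sum_congr rfl fun l hl => hoff l (Finset.ne_of_mem_erase hl) l₀ h0,
        Finset.sum_congr rfl fun l hl =>
          congrArg abs (hoff l (Finset.ne_of_mem_erase hl) l₀ h0)]
      simp [abs_mul]
  rw [← Finset.add_sum_erase _ _ (Finset.mem_univ k)] at hsum
  rw [hsplit, show ∑ l ∈ Finset.univ.erase k, A l = -A k by linarith, abs_neg]
  linarith

lemma integral_quadraticForm_le {V W : Fin n → Fin n → ℝ} {K : ℝ} (hV : ∀ i j, |V i j| ≤ K)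
    (hW : ∀ i j, |W i j| ≤ K) (hrow : ∀ i, ∑ j, W i j = 0) :
    ∫ π, ∑ k, ∑ l, V k l * W (π k) (π l) ∂(uniformPerm n) ≤ n * (2 * K ^ 2) := by
  rw [integral_finsetSum _ fun k _ => Integrable.of_finite]
  have : ∀ k, ∫ π, ∑ l, V k l * W (π k) (π l) ∂(uniformPerm n) ≤ 2 * K ^ 2 := by
    intro k
    have hK : 0 ≤ K := (abs_nonneg _).trans (hV k k)
    rw [integral_finsetSum _ fun l _ => Integrable.of_finite]
    calc ∑ l, ∫ π, V k l * W (π k) (π l) ∂(uniformPerm n)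
        ≤ ∑ l, K * |∫ π, W (π k) (π l) ∂(uniformPerm n)| := by
          refine Finset.sum_le_sum fun l _ => ?_
          rw [integral_const_mul]
          refine (le_abs_self _).trans ?_
          rw [abs_mul]
          exact mul_le_mul_of_nonneg_right (hV k l) (abs_nonneg _)
      _ ≤ K * (2 * K) := by
          rw [← Finset.mul_sum]
          exact mul_le_mul_of_nonneg_left (sum_abs_integral_uniformPerm_le hW hrow k) hK
      _ = 2 * K ^ 2 := by ring
  exact (Finset.sum_le_sum fun k _ => this k).trans (by simp)

/-- A transposition only affects the entries in two rows and two columns. -/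
lemma abs_quadraticForm_swap_sub_le {V W : Fin n → Fin n → ℝ} {K : ℝ} (hV : ∀ i j, |V i j| ≤ K)
    (hW : ∀ i j, |W i j| ≤ K) (a b : Fin n) (π : Perm (Fin n)) :
    |∑ k, ∑ l, V k l * W ((swap a b * π) k) ((swap a b * π) l)
      - ∑ k, ∑ l, V k l * W (π k) (π l)| ≤ 8 * K ^ 2 * n := by
  have hK : 0 ≤ K := (abs_nonneg _).trans (hV a a)
  set S : Fin n → ℝ := fun k => (if π k = a then 1 else 0) + (if π k = b then 1 else 0) with hS
  have hS0 : ∀ k, 0 ≤ S k := fun k => by simp only [hS]; positivity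
  have hSsum : ∑ k, S k = 2 := by
    simp only [hS, Finset.sum_add_distrib]
    rw [Equiv.sum_comp π (fun k => if k = a then (1 : ℝ) else 0),
      Equiv.sum_comp π (fun k => if k = b then (1 : ℝ) else 0)]
    norm_num
  have hS1 : ∀ k, 1 ≤ S k ∨ swap a b (π k) = π k := by
    intro k
    by_cases h1 : π k = a
    · left; simp only [hS, h1, if_true]; split_ifs <;> norm_num
    by_cases h2 : π k = b
    · left; simp only [hS, h2, if_true]; split_ifs <;> norm_num
    · exact Or.inr (swap_apply_of_ne_of_ne h1 h2)
  have hterm : ∀ k l, |V k l * W ((swap a b * π) k) ((swap a b * π) l) - V k l * W (π k) (π l)|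
      ≤ 2 * K ^ 2 * (S k + S l) := by
    intro k l
    have hcrude : |V k l * W ((swap a b * π) k) ((swap a b * π) l) - V k l * W (π k) (π l)|
        ≤ 2 * K ^ 2 := by
      rw [← mul_sub, abs_mul]
      calc _ ≤ K * (K + K) := mul_le_mul (hV k l)
            ((abs_sub _ _).trans (add_le_add (hW _ _) (hW _ _))) (abs_nonneg _) hK
        _ = 2 * K ^ 2 := by ring
    have hK2 : 0 ≤ 2 * K ^ 2 := by positivity
    rcases hS1 k with hk | hk
    · exact hcrude.trans (le_mul_of_one_le_right hK2 (by linarith [hS0 l]))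
    rcases hS1 l with hl | hl
    · exact hcrude.trans (le_mul_of_one_le_right hK2 (by linarith [hS0 k]))
    · rw [Perm.mul_apply, Perm.mul_apply, hk, hl, sub_self, abs_zero]
      exact mul_nonneg hK2 (add_nonneg (hS0 k) (hS0 l))
  rw [← Finset.sum_sub_distrib]
  simp_rw [← Finset.sum_sub_distrib]
  calc _ ≤ ∑ k, ∑ l, 2 * K ^ 2 * (S k + S l) :=
        (Finset.abs_sum_le_sum_abs _ _).trans (Finset.sum_le_sum fun k _ =>
          (Finset.abs_sum_le_sum_abs _ _).trans (Finset.sum_le_sum fun l _ => hterm k l))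
    _ = 8 * K ^ 2 * n := by
        simp only [← Finset.mul_sum, Finset.sum_add_distrib, hSsum, Finset.sum_const,
          Finset.card_univ, Fintype.card_fin, nsmul_eq_mul]
        ring

end QuadraticForms

/-! ### The permuted distance covariance -/

section PermutedDistanceCovariance

variable {H : Type*} [NormedAddCommGroup H] [InnerProductSpace ℝ H] [MeasurableSpace H]

variable {n : ℕ} (ν : ProbabilityMeasure H)

lemma abs_phi_le (w : H) : |phi ν w| ≤ 1 :=
  (Complex.abs_re_le_norm _).trans (norm_charFun_le_one _)

lemma abs_centred_le (x : Fin n → H) (k l : Fin n) : |centred ν x k l| ≤ 4 := by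
  have hn : (0 : ℝ) < n := by exact_mod_cast k.pos
  have hsum : ∀ u : Fin n → ℝ, (∀ i, |u i| ≤ 1) → |1 / (n : ℝ) * ∑ i, u i| ≤ 1 := by
    intro u hu
    rw [abs_mul, abs_of_nonneg (by positivity), one_div, inv_mul_le_iff₀ hn]
    exact (Finset.abs_sum_le_sum_abs _ _).trans
      ((Finset.sum_le_sum fun i _ => hu i).trans (by simp))
  have h1 := abs_le.1 (abs_phi_le ν (x k - x l))
  have h2 := abs_le.1 (hsum (fun i => phi ν (x i - x l)) fun i => abs_phi_le ν _)
  have h3 := abs_le.1 (hsum (fun j => phi ν (x k - x j)) fun j => abs_phi_le ν _)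
  have h4 := abs_le.1 (hsum (fun i => 1 / (n : ℝ) * ∑ j, phi ν (x i - x j))
    fun i => hsum _ fun j => abs_phi_le ν _)
  have e : 1 / (n : ℝ) * ∑ i, 1 / (n : ℝ) * ∑ j, phi ν (x i - x j)
      = 1 / (n : ℝ) ^ 2 * ∑ i, ∑ j, phi ν (x i - x j) := by
    rw [← Finset.mul_sum]
    ring
  rw [e] at h4
  unfold centred
  rw [abs_le]
  constructor <;> linarith

lemma sum_centred (x : Fin n → H) (k : Fin n) : ∑ l, centred ν x k l = 0 := by
  have hn : (n : ℝ) ≠ 0 := by exact_mod_cast k.pos.ne'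
  simp only [centred, Finset.sum_add_distrib, Finset.sum_sub_distrib, ← Finset.mul_sum,
    Finset.sum_const, Finset.card_univ, Fintype.card_fin, nsmul_eq_mul]
  rw [Finset.sum_comm (f := fun l i => phi ν (x i - x l))]
  field_simp
  ring

/-- Upper-tail bound for the permuted distance covariance, conditionally on the data. -/
lemma measureReal_le_permDCovSq_le (hn : n ≠ 0) (s : Fin n → H × H) {t : ℝ} (ht : 0 ≤ t) :
    (uniformPerm n).real {π | 32 / n + t ≤ permDCovSq ν s π}
      ≤ Real.exp (-(n * t ^ 2 / 32768)) := by
  have hn1 : (0 : ℝ) < n := by exact_mod_cast Nat.pos_of_ne_zero hn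
  have hV := abs_centred_le ν (fun j => (s j).1)
  have hW := abs_centred_le ν (fun j => (s j).2)
  have hmean : ∫ π, permDCovSq ν s π ∂(uniformPerm n) ≤ 32 / n := by
    simp only [permDCovSq]
    rw [integral_const_mul]
    have := integral_quadraticForm_le hV hW (sum_centred ν _)
    calc _ ≤ 1 / (n : ℝ) ^ 2 * (n * (2 * 4 ^ 2)) := mul_le_mul_of_nonneg_left this (by positivity)
      _ = 32 / n := by field_simp; norm_num
  have h := (hasSubgaussianMGF_uniformPerm (c := 128 / n) n (fun π => permDCovSq ν s π)
    (fun a b π => by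
      simp only [permDCovSq]
      rw [← mul_sub, abs_mul, abs_of_nonneg (by positivity)]
      calc _ ≤ 1 / (n : ℝ) ^ 2 * (8 * 4 ^ 2 * n) :=
            mul_le_mul_of_nonneg_left (abs_quadraticForm_swap_sub_le hV hW a b π) (by positivity)
        _ = ((128 / n : ℝ≥0) : ℝ) := by push_cast; field_simp; norm_num)).measure_ge_le ht
  refine (measureReal_mono ?_).trans (h.trans (le_of_eq ?_))
  · intro π hπ
    simp only [Set.mem_ofPred_eq] at hπ ⊢
    linarith
  · congr 1
    push_cast
    field_simp
    ring

lemma measurable_permDCovSq [BorelSpace H] [SecondCountableTopology H] :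
    Measurable fun p : (Fin n → H × H) × Equiv.Perm (Fin n) => permDCovSq ν p.1 p.2 := by
  have hphi : Measurable (phi ν) := Complex.measurable_re.comp measurable_charFun
  refine measurable_from_prod_countable_left fun π => ?_
  simp only [permDCovSq, centred]
  fun_prop

end PermutedDistanceCovariance

/-! ### The Monte Carlo step -/

/-- Hoeffding's inequality for the number of Monte Carlo draws that fall into a set of probability
at most `α / 2`. -/
lemma measureReal_le_card_le {X : Type*} [MeasurableSpace X] {μ : Measure X}
    [IsProbabilityMeasure μ] {B : ℕ} (hB : B ≠ 0) {S : Set X} [DecidablePred (· ∈ S)]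
    (hS : MeasurableSet S) {α : ℝ} (hα : 0 ≤ α) (hp : μ.real S ≤ α / 2) :
    (Measure.pi fun _ : Fin B => μ).real {x | B * α ≤ ∑ b, if x b ∈ S then (1 : ℝ) else 0}
      ≤ Real.exp (-(B * α ^ 2 / 2)) := by
  have hB1 : (0 : ℝ) < B := by exact_mod_cast Nat.pos_of_ne_zero hB
  have hm1 : Measurable fun x : X => if x ∈ S then (1 : ℝ) else 0 :=
    Measurable.ite hS measurable_const measurable_const
  have hm : Measurable fun x : Fin B → X => ∑ b, if x b ∈ S then (1 : ℝ) else 0 :=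
    Finset.measurable_fun_sum _ fun b _ => hm1.comp (measurable_pi_apply b)
  have h01 : ∀ x : X, 0 ≤ (if x ∈ S then (1 : ℝ) else 0) ∧ (if x ∈ S then (1 : ℝ) else 0) ≤ 1 :=
    fun x => by split_ifs <;> norm_num
  have hmean : ∫ x, ∑ b, (if x b ∈ S then (1 : ℝ) else 0) ∂(Measure.pi fun _ : Fin B => μ)
      ≤ B * (α / 2) := by
    have hint : ∀ b : Fin B, Integrable (fun x : Fin B → X => if x b ∈ S then (1 : ℝ) else 0)
        (Measure.pi fun _ : Fin B => μ) := fun b =>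
      Integrable.of_bound (hm1.comp (measurable_pi_apply b)).aestronglyMeasurable 1
        (Filter.Eventually.of_forall fun x => by
          rw [Real.norm_of_nonneg (h01 _).1]; exact (h01 _).2)
    rw [integral_finsetSum _ fun b _ => hint b]
    have hone : ∀ b : Fin B, ∫ x, (if x b ∈ S then (1 : ℝ) else 0)
        ∂(Measure.pi fun _ : Fin B => μ) = μ.real S := by
      intro b
      rw [integral_comp_eval (μ := fun _ : Fin B => μ)
        (f := fun z => if z ∈ S then (1 : ℝ) else 0) hm1.aestronglyMeasurable,
        ← integral_indicator_one hS]
      congr 1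
      ext x
      simp [Set.indicator_apply]
    simp only [hone, Finset.sum_const, Finset.card_univ, Fintype.card_fin, nsmul_eq_mul]
    exact mul_le_mul_of_nonneg_left hp hB1.le
  have h := (hasSubgaussianMGF_of_boundedDifferences (μ := μ) (c := 1) (M := B) B
    (fun x => ∑ b, if x b ∈ S then (1 : ℝ) else 0) hm
    (fun x => by
      rw [abs_of_nonneg (Finset.sum_nonneg fun b _ => (h01 _).1)]
      exact (Finset.sum_le_sum fun b _ => (h01 (x b)).2).trans (by simp))
    (fun i x y hxy => by
      rw [← Finset.sum_sub_distrib, Finset.sum_eq_single i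
        (fun j _ hj => by rw [hxy j hj, sub_self]) (by simp)]
      have h1 := (h01 (x i)).2
      have h2 := (h01 (y i)).1
      push_cast
      linarith)).measure_ge_le (ε := B * (α / 2)) (by positivity)
  refine (measureReal_mono ?_).trans (h.trans (le_of_eq ?_))
  · intro x hx
    simp only [Set.mem_ofPred_eq] at hx ⊢
    linarith
  · congr 1
    push_cast
    field_simp

/-! ### The type II error and the separation rate -/

variable {H : Type*} [NormedAddCommGroup H] [InnerProductSpace ℝ H] [MeasurableSpace H]

section

variable {n B : ℕ} (ν : ProbabilityMeasure H)

/-- A test that does not reject although the empirical distance covariance is at least `τ` sees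
at least a proportion `α` of the permuted statistics above `τ`. -/
lemma card_le_of_permTest_eq_zero {α τ : ℝ} (hB : B ≠ 0) {s : Fin n → H × H}
    {π : Fin B → Equiv.Perm (Fin n)} (h : permTest α ν s π = 0) (hτ : τ ≤ empDCovSq ν s) :
    B * α ≤ ∑ b, if τ ≤ permDCovSq ν s (π b) then (1 : ℝ) else 0 := by
  have hB1 : (0 : ℝ) < B := by exact_mod_cast Nat.pos_of_ne_zero hB
  have h1 : ¬ ((1 / (B : ℝ)) * ∑ b, (if empDCovSq ν s > permDCovSq ν s (π b)
      then (1 : ℝ) else 0) > 1 - α) := by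
    intro hc
    rw [permTest, if_pos hc] at h
    exact one_ne_zero h
  rw [not_lt, one_div, inv_mul_le_iff₀ hB1] at h1
  have h2 : (B : ℝ) ≤ (∑ b, if empDCovSq ν s > permDCovSq ν s (π b) then (1 : ℝ) else 0)
      + ∑ b, if τ ≤ permDCovSq ν s (π b) then (1 : ℝ) else 0 := by
    rw [← Finset.sum_add_distrib]
    calc (B : ℝ) = ∑ _b : Fin B, (1 : ℝ) := by simp
      _ ≤ _ := Finset.sum_le_sum fun b _ => by
        rcases le_or_gt τ (permDCovSq ν s (π b)) with hb | hb
        · rw [if_pos hb]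
          split_ifs <;> norm_num
        · rw [if_pos (hb.trans_le hτ)]
          split_ifs <;> norm_num
  linarith

variable [BorelSpace H] [SecondCountableTopology H]

/-- The probability that at least a proportion `α` of the permuted statistics is large. -/
lemma jointLaw_le_card_permDCovSq_le (F : ProbabilityMeasure (H × H)) (hn : n ≠ 0) (hB : B ≠ 0)
    {α t : ℝ} (hα : 0 ≤ α) (ht : 0 ≤ t) (hexp : Real.exp (-(n * t ^ 2 / 32768)) ≤ α / 2) :
    jointLaw F n B {ω | B * α ≤ ∑ b,
        if 32 / n + t ≤ permDCovSq ν ω.1 (ω.2 b) then (1 : ℝ) else 0}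
      ≤ ENNReal.ofReal (Real.exp (-(B * α ^ 2 / 2))) := by
  have hmeas : MeasurableSet {ω : (Fin n → H × H) × (Fin B → Equiv.Perm (Fin n)) |
      B * α ≤ ∑ b, if 32 / n + t ≤ permDCovSq ν ω.1 (ω.2 b) then (1 : ℝ) else 0} := by
    refine measurableSet_le measurable_const (Finset.measurable_fun_sum _ fun b _ => ?_)
    have hb : Measurable fun ω : (Fin n → H × H) × (Fin B → Equiv.Perm (Fin n)) =>
        (ω.1, ω.2 b) :=
      measurable_fst.prodMk ((measurable_pi_apply b).comp measurable_snd)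
    have hp := (measurable_permDCovSq (n := n) ν).comp hb
    exact Measurable.ite (measurableSet_le measurable_const hp) measurable_const measurable_const
  have hprob : IsProbabilityMeasure
      (Measure.pi fun _ : Fin B => (PMF.uniformOfFintype (Equiv.Perm (Fin n))).toMeasure) :=
    inferInstance
  rw [jointLaw, Measure.prod_apply hmeas]
  calc _ ≤ ∫⁻ _, ENNReal.ofReal (Real.exp (-(B * α ^ 2 / 2)))
          ∂(Measure.pi fun _ : Fin n => (F : Measure (H × H))) := by
        refine lintegral_mono fun s => ?_
        have h := measureReal_le_card_le (μ := uniformPerm n) hB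
          (S := {π | 32 / n + t ≤ permDCovSq ν s π}) (Set.toFinite _).measurableSet hα
          ((measureReal_le_permDCovSq_le ν hn s ht).trans hexp)
        rw [← ofReal_measureReal]
        exact ENNReal.ofReal_le_ofReal h
    _ = _ := by simp

/-- The type II error splits into the event that the empirical distance covariance is small and
the event that many permuted statistics are large. -/
lemma typeIIError_permTest_le (F : ProbabilityMeasure (H × H)) (hn : n ≠ 0) (hB : B ≠ 0)
    {α t u : ℝ} (hα : 0 ≤ α) (ht : 0 ≤ t) (hu : 0 ≤ u)
    (hexp : Real.exp (-(n * u ^ 2 / 32768)) ≤ α / 2)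
    (hsep : 32 / n + u ≤ dCovSq ν F - 8 / n - t) :
    typeIIError (n := n) (B := B) (permTest α) ν F
      ≤ ENNReal.ofReal (Real.exp (-(n * t ^ 2 / 288)) + Real.exp (-(B * α ^ 2 / 2))) := by
  set A : Set (Fin n → H × H) := {s | empDCovSq ν s ≤ dCovSq ν F - 8 / n - t} with hA
  have hsub : {ω : (Fin n → H × H) × (Fin B → Equiv.Perm (Fin n)) | permTest α ν ω.1 ω.2 = 0}
      ⊆ A ×ˢ Set.univ ∪ {ω | B * α ≤ ∑ b,
        if 32 / n + u ≤ permDCovSq ν ω.1 (ω.2 b) then (1 : ℝ) else 0} := by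
    intro ω hω
    by_cases h : empDCovSq ν ω.1 ≤ dCovSq ν F - 8 / n - t
    · exact Or.inl ⟨h, trivial⟩
    · exact Or.inr (card_le_of_permTest_eq_zero ν hB hω (hsep.trans (not_le.1 h).le))
  have hprob : IsProbabilityMeasure
      (Measure.pi fun _ : Fin B => (PMF.uniformOfFintype (Equiv.Perm (Fin n))).toMeasure) :=
    inferInstance
  rw [typeIIError, ENNReal.ofReal_add (Real.exp_nonneg _) (Real.exp_nonneg _)]
  refine (measure_mono hsub).trans ((measure_union_le _ _).trans (add_le_add ?_
    (jointLaw_le_card_permDCovSq_le ν F hn hB hα hu hexp)))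
  rw [jointLaw, Measure.prod_prod, measure_univ, mul_one, ← ofReal_measureReal]
  exact ENNReal.ofReal_le_ofReal (measureReal_empDCovSq_le F hn ν ht)

end

/-- Numerical form of the tail bounds: `exp (-2 L ^ 2) ≤ x / 2` as soon as `L ≥ 1` and
`L ≥ log x⁻¹`. -/
lemma exp_neg_two_mul_sq_le {x L : ℝ} (hx : 0 < x) (h1 : 1 ≤ L) (h2 : Real.log x⁻¹ ≤ L) :
    Real.exp (-(2 * L ^ 2)) ≤ x / 2 := by
  have he : Real.exp (-1) ≤ 1 / 2 := by
    rw [Real.exp_neg, one_div]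
    exact inv_anti₀ (by norm_num) (by linarith [Real.add_one_le_exp (1 : ℝ)])
  rw [Real.log_inv] at h2
  calc Real.exp (-(2 * L ^ 2)) ≤ Real.exp (Real.log x + -1) := Real.exp_le_exp.2 (by nlinarith)
    _ = x * Real.exp (-1) := by rw [Real.exp_add, Real.exp_log hx]
    _ ≤ x / 2 := by nlinarith

end DistCov

end

theorem mainTheorem3 :
    ∃ c : ℝ, 0 < c ∧
      ∀ (H : Type*) [NormedAddCommGroup H] [InnerProductSpace ℝ H] [CompleteSpace H]
        [TopologicalSpace.SeparableSpace H] [MeasurableSpace H] [BorelSpace H],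
        ¬ FiniteDimensional ℝ H →
        ∀ (α β : ℝ) (n B : ℕ),
          0 < α → 0 < β → α + β < 1 → β < 1 / Real.exp 1 → 4 ≤ n →
          2 * (α ^ 2)⁻¹ * Real.log (6 / β) ≤ (B : ℝ) →
          DistCov.uniformSeparationRate (H := H) (n := n) (B := B) (DistCov.permTest α) β
            ≤ ENNReal.ofReal
                (c * (n : ℝ) ^ (-(1 / 2) : ℝ) * (Real.log α⁻¹ + Real.log β⁻¹)) := by
  -- `320 = 8 + 24 + 32 + 256`: the bias and the deviation of the empirical statistic, then the
  -- mean and the deviation of the permuted ones.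
  refine ⟨320, by norm_num, ?_⟩
  intro H _ _ _ _ _ _ _ α β n B hα hβ hαβ hβe hn hBlog
  have : SecondCountableTopology H := UniformSpace.secondCountable_of_separable H
  set L := Real.log α⁻¹ + Real.log β⁻¹ with hL
  set r := (n : ℝ) ^ (-(1 / 2) : ℝ) with hr
  have hn0 : n ≠ 0 := by omega
  have hn1 : (0 : ℝ) < n := by exact_mod_cast Nat.pos_of_ne_zero hn0
  have hr0 : 0 < r := Real.rpow_pos_of_pos hn1 _
  have hr2 : r ^ 2 = 1 / n := by
    rw [hr, ← Real.rpow_natCast, ← Real.rpow_mul hn1.le]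
    norm_num
    exact Real.rpow_neg_one _
  have hr1 : r ≤ 1 := Real.rpow_le_one_of_one_le_of_nonpos
    (by exact_mod_cast Nat.one_le_iff_ne_zero.2 hn0) (by norm_num)
  have hlα : 0 ≤ Real.log α⁻¹ := Real.log_nonneg ((one_le_inv₀ hα).2 (by linarith))
  have hlβ : 1 ≤ Real.log β⁻¹ := by
    rw [Real.le_log_iff_exp_le (inv_pos.2 hβ)]
    rw [one_div] at hβe
    exact (le_inv_comm₀ hβ (Real.exp_pos 1)).1 hβe.le
  have hL1 : 1 ≤ L := by linarith
  have hrL : 1 / (n : ℝ) ≤ r * L := by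
    rw [← hr2]
    nlinarith
  have hnr : (n : ℝ) * r ^ 2 = 1 := by
    rw [hr2]
    field_simp
  have hlog6 : 0 < Real.log (6 / β) := by
    refine Real.log_pos ?_
    rw [one_lt_div hβ]
    linarith
  have hB1 : (0 : ℝ) < B := lt_of_lt_of_le (by positivity) hBlog
  have hB0 : B ≠ 0 := by
    rintro rfl
    simp at hB1
  have hexpB : Real.exp (-(B * α ^ 2 / 2)) ≤ β / 6 := by
    have h : Real.log (6 / β) ≤ B * α ^ 2 / 2 := by
      have h' := mul_le_mul_of_nonneg_right hBlog (sq_nonneg α)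
      have e : 2 * (α ^ 2)⁻¹ * Real.log (6 / β) * α ^ 2 = 2 * Real.log (6 / β) := by
        field_simp
      linarith
    calc _ ≤ Real.exp (-Real.log (6 / β)) := Real.exp_le_exp.2 (neg_le_neg h)
      _ = β / 6 := by rw [Real.exp_neg, Real.exp_log (by positivity), inv_div]
  refine sInf_le ⟨320 * r * L, by positivity, rfl, ?_⟩
  refine iSup₂_le fun ν _ => iSup₂_le fun F hF => ?_
  have hF' : 320 * r * L ≤ DistCov.dCovSq ν F := hF
  refine (DistCov.typeIIError_permTest_le ν F hn0 hB0 (t := 24 * (r * L)) (u := 256 * (r * L))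
    hα.le (by positivity) (by positivity) ?_ ?_).trans (ENNReal.ofReal_le_ofReal ?_)
  · have e : n * (256 * (r * L)) ^ 2 / 32768 = 2 * L ^ 2 := by
      linear_combination 2 * L ^ 2 * hnr
    rw [e]
    exact DistCov.exp_neg_two_mul_sq_le hα hL1 (by linarith)
  · have e1 : (32 : ℝ) / n = 32 * (1 / n) := by ring
    have e2 : (8 : ℝ) / n = 8 * (1 / n) := by ring
    rw [e1, e2]
    linarith
  · have e : n * (24 * (r * L)) ^ 2 / 288 = 2 * L ^ 2 := by
      linear_combination 2 * L ^ 2 * hnr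
    rw [e]
    have := DistCov.exp_neg_two_mul_sq_le hβ hL1 (by linarith)
    linarith
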